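/- Let $N$ be a finite set with $n$ elements. A partial Latin square $P$ of order $n$, indexed by $N$, is a non-empty set $P\subseteq N\times N\times N$ of triples (row, column, symbol) such that any two triples of $P$ that agree in two coordinates agree in the third. It is a Latin square if $|P|=n^2$, and it is idempotent if $(a,a,a)\in P$ for all $a\in N$. Two Latin squares $X,Y$ indexed by the same set are orthogonal if any two distinct cells that contain equal symbols in $X$ contain different symbols in $Y$. A Latin square $B$ has at least $s$ mutually orthogonal mates if there is a set of at least $s$ Latin squares, indexed by the same set as $B$, which are pairwise orthogonal and each orthogonal to $B$. A partial Latin square $P$ indexed by $N$ is embedded in a Latin square $B$ indexed by $M$ if there are injective maps $f_1,f_2,f_3:N\to M$ such that $(x_1,x_2,x_3)\in P$ implies $(f_1(x_1),f_2(x_2),f_3(x_3))\in B$. Theorem. Let $n\ge 3$ and let $P$ be a partial Latin square of order $n$. Then $P$ can be embedded in a Latin square $B$ of order at most $16n^2$ that has at least $2n$ mutually orthogonal mates. Furthermore, if $P$ is idempotent, then $B$ can be chosen to be idempotent as well, while keeping all these properties. -/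

import Mathlib

/-- A partial Latin square indexed by the finite set `N` (its order is the cardinality of `N`):
a non-empty set of triples (row, column, symbol) in which any two coordinates determine
the third. -/
def IsPartialLatinSquare {N : Type*} (P : Finset (N × N × N)) : Prop :=
  P.Nonempty ∧
  (∀ r c e e', (r, c, e) ∈ P → (r, c, e') ∈ P → e = e') ∧
  (∀ r c c' e, (r, c, e) ∈ P → (r, c', e) ∈ P → c = c') ∧
  (∀ r r' c e, (r, c, e) ∈ P → (r', c, e) ∈ P → r = r')

/-- A Latin square: a partial Latin square of order `n` with exactly `n ^ 2` triples. -/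
def IsLatinSquare {N : Type*} [Fintype N] (L : Finset (N × N × N)) : Prop :=
  IsPartialLatinSquare L ∧ L.card = Fintype.card N ^ 2

/-- Every index `a` occurs as the symbol in its own diagonal cell `(a, a)`. -/
def IsIdempotentSquare {N : Type*} (P : Finset (N × N × N)) : Prop :=
  ∀ a, (a, a, a) ∈ P

/-- Orthogonality: the same cells are non-empty, and no two distinct cells that hold equal
symbols in `P` hold equal symbols in `Q`. -/
def OrthogonalSquares {N : Type*} (P Q : Finset (N × N × N)) : Prop :=
  (∀ r c, (∃ e, (r, c, e) ∈ P) ↔ (∃ e, (r, c, e) ∈ Q)) ∧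
  ∀ r₁ c₁ r₂ c₂ x y, (r₁, c₁) ≠ (r₂, c₂) →
    (r₁, c₁, x) ∈ P ∧ (r₂, c₂, x) ∈ P → ¬ ((r₁, c₁, y) ∈ Q ∧ (r₂, c₂, y) ∈ Q)

/-- `P`, indexed by `N`, is embedded in `L`, indexed by `M`: there are injections of the rows,
the columns and the symbols (not required to be equal) that map the triples of `P` to
triples of `L`. -/
def EmbedsInSquare {N M : Type*} (P : Finset (N × N × N)) (L : Finset (M × M × M)) : Prop :=
  ∃ f₁ f₂ f₃ : N → M, Function.Injective f₁ ∧ Function.Injective f₂ ∧ Function.Injective f₃ ∧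
    ∀ x₁ x₂ x₃, (x₁, x₂, x₃) ∈ P → (f₁ x₁, f₂ x₂, f₃ x₃) ∈ L

/-- `B` has a set `S` of at least `s` mutually orthogonal mates: the members of `S` are Latin
squares indexed by the same set as `B`, orthogonal to `B`, and pairwise orthogonal. -/
def HasOrthogonalMates {M : Type*} [Fintype M] (B : Finset (M × M × M)) (s : ℕ) : Prop :=
  ∃ S : Finset (Finset (M × M × M)), s ≤ S.card ∧
    (∀ X ∈ S, IsLatinSquare X ∧ OrthogonalSquares B X) ∧
    ∀ X ∈ S, ∀ Y ∈ S, X ≠ Y → OrthogonalSquares X Y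

/-! Bertrand's postulate gives a prime `p` with `2n < p ≤ 4n`. By Evans' theorem, which rests on
Hall and König, `P` sits in a Latin square `A` on `F = ZMod p`. The square `B` is, up to isotopy,
the product of `A` with the addition table of `F`, of order `p ^ 2 ≤ 16 n ^ 2`. Its mates are the
linear squares `linearMate b`, `b ≠ 0`: they mix the two coordinates so that orthogonality uses only
that the columns of `A` are injective. There are `p - 1 ≥ 2n` of them. Since embeddings may treat
rows, columns and symbols differently, a transversal of the product can be moved to the diagonal,
which gives idempotency. -/

/-! ### Bipartite edge colouring. -/

open Finset in
/-- A nonnegative integer matrix all of whose row and column sums equal `d` is a sum of `d`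
permutation matrices; only the resulting covering of the support is recorded. -/
theorem exists_equivs_covering_of_regular {α β : Type*} [Fintype α] [Fintype β] (d : ℕ)
    (M : α → β → ℕ) (hrow : ∀ i, ∑ j, M i j = d) (hcol : ∀ j, ∑ i, M i j = d) :
    ∃ σ : Fin d → α ≃ β, ∀ i j, M i j ≠ 0 → ∃ k, σ k i = j := by
  classical
  induction d generalizing M with
  | zero =>
    refine ⟨fun k => k.elim0, fun i j h => (h ?_).elim⟩
    have := hrow i
    rw [Finset.sum_eq_zero_iff] at this
    exact this j (mem_univ j)
  | succ d ih =>
    have hcard : Fintype.card α = Fintype.card β := by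
      have h : ∑ i, ∑ j, M i j = ∑ j, ∑ i, M i j := Finset.sum_comm
      simp only [hrow, hcol, sum_const, card_univ, smul_eq_mul] at h
      exact Nat.eq_of_mul_eq_mul_right d.succ_pos h
    -- Hall's condition by double counting: the rows in `s` have weight `#s * (d + 1)`, all of it in
    -- the columns of `t`, whose total weight is `#t * (d + 1)`.
    obtain ⟨f, hf, hfM⟩ := (Finset.all_card_le_biUnion_card_iff_exists_injective
      (fun i => univ.filter fun j => M i j ≠ 0)).1 (by
        intro s
        set t := s.biUnion fun i => univ.filter fun j => M i j ≠ 0 with ht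
        refine Nat.le_of_mul_le_mul_right (c := d + 1) ?_ d.succ_pos
        calc #s * (d + 1) = ∑ i ∈ s, ∑ j, M i j := by simp [hrow]
          _ = ∑ i ∈ s, ∑ j ∈ t, M i j := by
            refine sum_congr rfl fun i hi => (sum_subset (subset_univ t) ?_).symm
            intro j _ hj
            by_contra h
            exact hj (mem_biUnion.2 ⟨i, hi, by simpa using h⟩)
          _ = ∑ j ∈ t, ∑ i ∈ s, M i j := sum_comm
          _ ≤ ∑ j ∈ t, ∑ i, M i j := sum_le_sum fun j _ =>
            sum_le_sum_of_subset (subset_univ s)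
          _ = #t * (d + 1) := by simp [hcol])
    let τ : α ≃ β := Equiv.ofBijective f ((Fintype.bijective_iff_injective_and_card f).2 ⟨hf, hcard⟩)
    have hτ : ∀ i, M i (τ i) ≠ 0 := fun i => (mem_filter.1 (hfM i)).2
    have hle : ∀ i j, (if τ i = j then 1 else 0) ≤ M i j := by
      intro i j
      split_ifs with h
      · exact h ▸ Nat.one_le_iff_ne_zero.2 (hτ i)
      · exact Nat.zero_le _
    obtain ⟨σ, hσ⟩ := ih (fun i j => M i j - if τ i = j then 1 else 0)
      (fun i => by
        rw [sum_tsub_distrib _ fun j _ => hle i j, hrow]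
        simp)
      (fun j => by
        rw [sum_tsub_distrib _ fun i _ => hle i j, hcol]
        simp [← Equiv.eq_symm_apply])
    refine ⟨Fin.cons τ σ, fun i j h => ?_⟩
    by_cases hij : τ i = j
    · exact ⟨0, by simpa using hij⟩
    · obtain ⟨k, hk⟩ := hσ i j (by simpa [hij] using h)
      exact ⟨k.succ, by simpa using hk⟩

open Finset in
/-- König's line colouring theorem: a bipartite graph of maximum degree at most `d` has a proper
edge colouring with `d` colours. -/
theorem exists_bipartite_edge_coloring {α β : Type*} [Fintype α] [Fintype β] (d : ℕ)
    (E : α → β → Prop) [∀ i j, Decidable (E i j)]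
    (hrow : ∀ i, #{j | E i j} ≤ d) (hcol : ∀ j, #{i | E i j} ≤ d) :
    ∃ c : (i : α) → (j : β) → E i j → Fin d,
      (∀ i j j' h h', c i j h = c i j' h' → j = j') ∧
      ∀ i i' j h h', c i j h = c i' j h' → i = i' := by
  classical
  let M : α → β → ℕ := fun i j => if E i j then 1 else 0
  have hr : ∀ i, ∑ j, M i j ≤ d := fun i => by simpa [M] using hrow i
  have hc : ∀ j, ∑ i, M i j ≤ d := fun j => by simpa [M] using hcol j
  -- Regularise by doubling: the block matrix with `M` and its transpose on the diagonal, and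
  -- diagonal matrices of row and column deficits off it.
  obtain ⟨σ, hσ⟩ := exists_equivs_covering_of_regular d
    (Sum.elim (fun i => Sum.elim (M i) fun i' => if i = i' then d - ∑ j, M i j else 0)
      fun j => Sum.elim (fun j' => if j' = j then d - ∑ i, M i j' else 0) fun i => M i j)
    (by
      rintro (i | j)
      · simp only [Fintype.sum_sum_type, Sum.elim_inl, Sum.elim_inr, sum_ite_eq,
          mem_univ, if_true]
        exact Nat.add_sub_of_le (hr i)
      · simp only [Fintype.sum_sum_type, Sum.elim_inl, Sum.elim_inr, sum_ite_eq',
          mem_univ, if_true]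
        exact Nat.sub_add_cancel (hc j))
    (by
      rintro (j | i)
      · simp only [Fintype.sum_sum_type, Sum.elim_inl, Sum.elim_inr, sum_ite_eq,
          mem_univ, if_true]
        exact Nat.add_sub_of_le (hc j)
      · simp only [Fintype.sum_sum_type, Sum.elim_inl, Sum.elim_inr, sum_ite_eq',
          mem_univ, if_true]
        exact Nat.sub_add_cancel (hr i))
  have key : ∀ i j, E i j → ∃ k, σ k (Sum.inl i) = Sum.inl j := fun i j h =>
    hσ (Sum.inl i) (Sum.inl j) (by simp [M, h])
  choose c hc using key
  refine ⟨c, fun i j j' h h' heq => ?_, fun i i' j h h' heq => ?_⟩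
  · exact Sum.inl_injective ((hc i j h).symm.trans ((congrArg (σ · _) heq).trans (hc i j' h')))
  · exact Sum.inl_injective ((σ (c i j h)).injective
      ((hc i j h).trans ((hc i' j h').symm.trans (congrArg (σ · _) heq).symm)))

/-! ### Completing Latin arrays; Evans' theorem. -/

open Finset in
/-- A Latin array can be widened to as many columns as there are symbols, provided that every symbol
is missing from at most as many rows as there are columns to add. -/
theorem exists_extend_columns {α β T : Type*} [Fintype α] [Fintype β] [Fintype T] [DecidableEq T]
    (U : α → β → T) (hrow : ∀ i, Function.Injective (U i))
    (hcol : ∀ j, Function.Injective fun i => U i j) (d : ℕ)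
    (hd : Fintype.card β + d = Fintype.card T)
    (hmiss : ∀ s, #{i | ∀ j, U i j ≠ s} ≤ d) :
    ∃ V : α → β ⊕ Fin d → T, (∀ i j, V i (Sum.inl j) = U i j) ∧
      (∀ i, Function.Injective (V i)) ∧ ∀ j, Function.Injective fun i => V i j := by
  have hdeg : ∀ i, #{s | ∀ j, U i j ≠ s} = d := by
    intro i
    have h1 : (univ.filter fun s => ∀ j, U i j ≠ s) = (univ.image (U i))ᶜ := by
      ext s; simp
    rw [h1, card_compl, card_image_of_injective _ (hrow i), card_univ, ← hd]
    omega
  -- Join each row to the symbols it lacks; the colour classes are the new columns. Each row lacks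
  -- exactly `d` symbols, so it meets every colour.
  obtain ⟨c, hc1, hc2⟩ := exists_bipartite_edge_coloring d (fun i s => ∀ j, U i j ≠ s)
    (fun i => (hdeg i).le) hmiss
  have hsurj : ∀ i k, ∃ s, ∃ h : ∀ j, U i j ≠ s, c i s h = k := by
    intro i
    have hbij : Function.Bijective fun s : {s // ∀ j, U i j ≠ s} => c i s.1 s.2 :=
      (Fintype.bijective_iff_injective_and_card _).2
        ⟨fun s s' h => Subtype.ext (hc1 _ _ _ _ _ h), by
          rw [Fintype.card_subtype, hdeg i, Fintype.card_fin]⟩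
    intro k
    obtain ⟨s, hs⟩ := hbij.2 k
    exact ⟨s.1, s.2, hs⟩
  choose W hW hWc using hsurj
  refine ⟨fun i => Sum.elim (U i) (W i), fun i j => rfl, fun i => ?_, ?_⟩
  · refine Function.Injective.sumElim (hrow i) (fun k k' h => ?_) fun j k => hW i k j
    rw [← hWc i k, ← hWc i k']
    congr 1
  · rintro (j | k)
    · exact hcol j
    · intro i i' h
      have h : W i k = W i' k := h
      have h' : ∀ j, U i' j ≠ W i k := h ▸ hW i' k
      refine hc2 i i' (W i k) (hW i k) h' ((hWc i k).trans ((hWc i' k).symm.trans ?_))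
      congr 1
      exact h.symm

open Finset in
/-- A Latin array of size `n × n` on at least `2 n` symbols is the corner of a Latin square. -/
theorem exists_extend_to_latin {N T : Type*} [Fintype N] [Fintype T]
    (U : N → N → T) (hrow : ∀ i, Function.Injective (U i))
    (hcol : ∀ j, Function.Injective fun i => U i j)
    (hT : 2 * Fintype.card N ≤ Fintype.card T) :
    ∃ (A : T → T → T) (f g : N → T), Function.Injective f ∧ Function.Injective g ∧
      (∀ i j, A (f i) (g j) = U i j) ∧ (∀ x, Function.Injective (A x)) ∧
      ∀ y, Function.Injective fun x => A x y := by
  classical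
  obtain ⟨d, hd⟩ : ∃ d, Fintype.card N + d = Fintype.card T :=
    ⟨Fintype.card T - Fintype.card N, by omega⟩
  obtain ⟨V, hVU, hV1, hV2⟩ := exists_extend_columns U hrow hcol d hd fun s =>
    (card_le_univ _).trans (by omega)
  have hVbij : ∀ i, Function.Bijective (V i) := fun i =>
    (Fintype.bijective_iff_injective_and_card _).2 ⟨hV1 i, by simpa using hd⟩
  -- Add rows by transposing. The rows of `V` are full, so each symbol already lies in `Fintype.card
  -- N` distinct columns and is missing from only `d`.
  obtain ⟨W, hWV, hW1, hW2⟩ := exists_extend_columns (fun j i => V i j) hV2 hV1 d hd (by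
    intro s
    choose φ hφ using fun i => (hVbij i).2 s
    have hφi : Function.Injective φ := fun i i' h => hV2 (φ i) (by
      change V i (φ i) = V i' (φ i)
      rw [hφ i, h, hφ i'])
    have hsub : (univ.filter fun j => ∀ i, V i j ≠ s) ⊆ (univ.image φ)ᶜ := by
      intro j hj
      simp only [mem_filter, mem_univ, true_and, mem_compl, mem_image, not_exists] at hj ⊢
      exact fun i h => hj i (h ▸ hφ i)
    refine (card_le_card hsub).trans ?_
    rw [card_compl, card_image_of_injective _ hφi]
    simp)
  have e : T ≃ N ⊕ Fin d := Fintype.equivOfCardEq (by simpa using hd.symm)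
  refine ⟨fun x y => W (e y) (e x), fun i => e.symm (Sum.inl i), fun i => e.symm (Sum.inl i),
    e.symm.injective.comp Sum.inl_injective, e.symm.injective.comp Sum.inl_injective,
    fun i j => ?_, fun x => (hW2 (e x)).comp e.injective, fun y => (hW1 (e y)).comp e.injective⟩
  simp only [Equiv.apply_symm_apply]
  rw [hWV, hVU]

/-- Evans' theorem: a partial Latin square of order `n` embeds in a Latin square of every order at
least `2 n`. -/
theorem exists_latin_extending_partial {N T : Type*} [Fintype N] [Fintype T]
    {P : Finset (N × N × N)} (hP : IsPartialLatinSquare P)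
    (hT : 2 * Fintype.card N ≤ Fintype.card T) :
    ∃ (A : T → T → T) (f₁ f₂ f₃ : N → T), Function.Injective f₁ ∧ Function.Injective f₂ ∧
      Function.Injective f₃ ∧ (∀ r c e, (r, c, e) ∈ P → A (f₁ r) (f₂ c) = f₃ e) ∧
      (∀ x, Function.Injective (A x)) ∧ ∀ y, Function.Injective fun x => A x y := by
  classical
  obtain ⟨⟨⟨r₀, -⟩, -⟩, hsym, hcol, hrow⟩ := hP
  have : NeZero (Fintype.card N) := ⟨(Fintype.card_pos_iff.2 ⟨r₀⟩).ne'⟩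
  have ε := Fintype.equivFin N
  obtain ⟨g⟩ : Nonempty (N ⊕ Fin (Fintype.card N) ↪ T) :=
    Function.Embedding.nonempty_of_card_le (by simpa [two_mul] using hT)
  -- Fill the empty cells from a cyclic table on `n` fresh symbols.
  let Z : N → N → N ⊕ Fin (Fintype.card N) := fun r c =>
    if h : ∃ e, (r, c, e) ∈ P then Sum.inl h.choose else Sum.inr (ε r + ε c)
  have hZ : ∀ r c e, (r, c, e) ∈ P → Z r c = Sum.inl e := by
    intro r c e he
    have h : ∃ e, (r, c, e) ∈ P := ⟨e, he⟩
    simp only [Z, dif_pos h]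
    exact congrArg _ (hsym r c _ _ h.choose_spec he)
  have hZ' : ∀ r c, (∃ e, (r, c, e) ∈ P ∧ Z r c = Sum.inl e) ∨ Z r c = Sum.inr (ε r + ε c) := by
    intro r c
    by_cases h : ∃ e, (r, c, e) ∈ P
    · exact Or.inl ⟨h.choose, h.choose_spec, hZ _ _ _ h.choose_spec⟩
    · exact Or.inr (by simp only [Z, dif_neg h])
  obtain ⟨A, f₁, f₂, h₁, h₂, hA, hA1, hA2⟩ := exists_extend_to_latin (fun r c => g (Z r c))
    (by
      refine fun r => g.injective.comp fun c c' h => ?_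
      rcases hZ' r c with ⟨e, he, hz⟩ | hz <;> rcases hZ' r c' with ⟨e', he', hz'⟩ | hz' <;>
        simp only [hz, hz'] at h
      · exact hcol r c c' e he (Sum.inl_injective h ▸ he')
      · exact absurd h Sum.inl_ne_inr
      · exact absurd h Sum.inr_ne_inl
      · exact ε.injective (add_left_cancel (Sum.inr_injective h)))
    (by
      refine fun c => g.injective.comp fun r r' h => ?_
      rcases hZ' r c with ⟨e, he, hz⟩ | hz <;> rcases hZ' r' c with ⟨e', he', hz'⟩ | hz' <;>
        simp only [hz, hz'] at h
      · exact hrow r r' c e he (Sum.inl_injective h ▸ he')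
      · exact absurd h Sum.inl_ne_inr
      · exact absurd h Sum.inr_ne_inl
      · exact ε.injective (add_right_cancel (Sum.inr_injective h)))
    hT
  exact ⟨A, f₁, f₂, fun e => g (Sum.inl e), h₁, h₂, g.injective.comp Sum.inl_injective,
    fun r c e he => by rw [hA, hZ r c e he], hA1, hA2⟩

/-! ### From operations to sets of triples. -/

/-- The set of triples of a binary operation. -/
def tripleSet {M : Type*} [Fintype M] (L : M → M → M) : Finset (M × M × M) :=
  Finset.univ.map ⟨fun x : M × M => (x.1, x.2, L x.1 x.2), fun x y h => by
    simp only [Prod.mk.injEq] at h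
    exact Prod.ext h.1 h.2.1⟩

theorem mem_tripleSet {M : Type*} [Fintype M] {L : M → M → M} {r c e : M} :
    (r, c, e) ∈ tripleSet L ↔ L r c = e := by
  simp only [tripleSet, Finset.mem_map, Finset.mem_univ, true_and]
  constructor
  · rintro ⟨_, h⟩
    cases h
    rfl
  · rintro rfl
    exact ⟨(r, c), rfl⟩

theorem tripleSet_injective {M : Type*} [Fintype M] :
    Function.Injective (tripleSet : (M → M → M) → Finset (M × M × M)) := by
  intro L L' h
  funext r c
  have h1 : (r, c, L r c) ∈ tripleSet L := mem_tripleSet.2 rfl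
  rw [h] at h1
  exact (mem_tripleSet.1 h1).symm

theorem isLatinSquare_tripleSet {M : Type*} [Fintype M] [Nonempty M] {L : M → M → M}
    (hrow : ∀ x, Function.Injective (L x)) (hcol : ∀ y, Function.Injective fun x => L x y) :
    IsLatinSquare (tripleSet L) := by
  refine ⟨⟨?_, ?_, ?_, ?_⟩, ?_⟩
  · simp [tripleSet]
  · simp only [mem_tripleSet]
    exact fun r c e e' h h' => h.symm.trans h'
  · simp only [mem_tripleSet]
    exact fun r c c' e h h' => hrow r (h.trans h'.symm)
  · simp only [mem_tripleSet]
    exact fun r r' c e h h' => hcol c (h.trans h'.symm)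
  · simp [tripleSet, sq]

theorem orthogonalSquares_tripleSet {M : Type*} [Fintype M] {L L' : M → M → M}
    (h : ∀ r c r' c', L r c = L r' c' → L' r c = L' r' c' → r = r' ∧ c = c') :
    OrthogonalSquares (tripleSet L) (tripleSet L') := by
  refine ⟨fun r c => by simp [mem_tripleSet], ?_⟩
  simp only [mem_tripleSet]
  rintro r c r' c' x y hne ⟨h1, h2⟩ ⟨h3, h4⟩
  obtain ⟨rfl, rfl⟩ := h r c r' c' (h1.trans h2.symm) (h3.trans h4.symm)
  exact hne rfl

/-! ### The product square and its linear mates. -/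

/-- The product of a Latin square on `F` with the addition table of `F`. -/
def prodAddSquare {F : Type*} [Add F] (A : F → F → F) (x y : F × F) : F × F :=
  (A x.1 y.1, x.2 + y.2)

/-- A linear mate of `prodAddSquare A`. -/
def linearMate {F : Type*} [Field F] (b : F) (x y : F × F) : F × F :=
  (x.1 + b * y.2, x.2 + b * y.1 + y.2)

section Mates

variable {F : Type*} [Field F]

theorem prodAddSquare_injective_right {A : F → F → F} (hA : ∀ x, Function.Injective (A x))
    (x : F × F) : Function.Injective (prodAddSquare A x) := by
  intro y y' h
  simp only [prodAddSquare, Prod.mk.injEq, add_right_inj] at h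
  exact Prod.ext (hA _ h.1) h.2

theorem prodAddSquare_injective_left {A : F → F → F}
    (hA : ∀ y, Function.Injective fun x => A x y) (y : F × F) :
    Function.Injective fun x => prodAddSquare A x y := by
  intro x x' h
  simp only [prodAddSquare, Prod.mk.injEq, add_left_inj] at h
  exact Prod.ext (hA _ h.1) h.2

theorem linearMate_injective_right {b : F} (hb : b ≠ 0) (x : F × F) :
    Function.Injective (linearMate b x) := by
  rintro ⟨y1, y2⟩ ⟨z1, z2⟩ h
  simp only [linearMate, Prod.mk.injEq, add_right_inj, mul_eq_mul_left_iff, hb, or_false] at h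
  obtain ⟨rfl, h⟩ := h
  simpa [hb] using h

theorem linearMate_injective_left (b : F) (y : F × F) :
    Function.Injective fun x => linearMate b x y := by
  rintro ⟨x1, x2⟩ ⟨z1, z2⟩ h
  simpa [linearMate] using h

/-- The second coordinates of the two symbols differ by `b * y.1`, which reveals `y.1`; then column
`y.1` of `A` reveals `x.1`, and the rest is linear. -/
theorem prodAddSquare_linearMate_orthogonal {A : F → F → F}
    (hA : ∀ y, Function.Injective fun x => A x y) {b : F} (hb : b ≠ 0) (x y x' y' : F × F)
    (h : prodAddSquare A x y = prodAddSquare A x' y')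
    (h' : linearMate b x y = linearMate b x' y') : x = x' ∧ y = y' := by
  obtain ⟨x1, x2⟩ := x
  obtain ⟨y1, y2⟩ := y
  obtain ⟨z1, z2⟩ := x'
  obtain ⟨w1, w2⟩ := y'
  simp only [prodAddSquare, linearMate, Prod.mk.injEq] at h h'
  obtain ⟨h1, h2⟩ := h
  obtain ⟨h3, h4⟩ := h'
  have e1 : y1 = w1 := mul_left_cancel₀ hb (by linear_combination h4 - h2)
  subst e1
  have e2 : x1 = z1 := hA y1 h1
  subst e2
  have e3 : y2 = w2 := mul_left_cancel₀ hb (by linear_combination h3)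
  subst e3
  exact ⟨Prod.ext rfl (by linear_combination h2), rfl⟩

theorem linearMate_orthogonal {b b' : F} (hb : b ≠ b') (x y x' y' : F × F)
    (h : linearMate b x y = linearMate b x' y')
    (h' : linearMate b' x y = linearMate b' x' y') : x = x' ∧ y = y' := by
  obtain ⟨x1, x2⟩ := x
  obtain ⟨y1, y2⟩ := y
  obtain ⟨z1, z2⟩ := x'
  obtain ⟨w1, w2⟩ := y'
  simp only [linearMate, Prod.mk.injEq] at h h'
  obtain ⟨h1, h2⟩ := h
  obtain ⟨h3, h4⟩ := h'
  have hb' := sub_ne_zero.2 hb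
  have e1 : y2 = w2 := mul_left_cancel₀ hb' (by linear_combination h1 - h3)
  have e2 : y1 = w1 := mul_left_cancel₀ hb' (by linear_combination h2 - h4)
  subst e1 e2
  exact ⟨Prod.ext (by linear_combination h1) (by linear_combination h2), rfl⟩

theorem linearMate_injective : Function.Injective (linearMate : F → F × F → F × F → F × F) := by
  intro b b' h
  simpa [linearMate] using congrArg Prod.fst (congrFun (congrFun h 0) (0, 1))

end Mates

/-! ### Assembling the square. -/

theorem mainTheorem1 {N : Type*} [Fintype N] (n : ℕ) (hN : Fintype.card N = n) (hn : 3 ≤ n)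
    (P : Finset (N × N × N)) (hP : IsPartialLatinSquare P) :
    ∃ (m : ℕ) (B : Finset (Fin m × Fin m × Fin m)),
      m ≤ 16 * n ^ 2 ∧ IsLatinSquare B ∧ EmbedsInSquare P B ∧ HasOrthogonalMates B (2 * n) ∧
      (IsIdempotentSquare P → IsIdempotentSquare B) := by
  classical
  obtain ⟨p, hp, hlt, hle⟩ := Nat.exists_prime_lt_and_le_two_mul (2 * n) (by omega)
  have : Fact p.Prime := ⟨hp⟩
  let F := ZMod p
  obtain ⟨A, f₁, f₂, f₃, h₁, h₂, h₃, hA, hA1, hA2⟩ :=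
    exists_latin_extending_partial (T := F) hP (by rw [hN, ZMod.card]; exact hlt.le)
  -- the cells `(ρ z, z)` carry the symbol `0` in a mate, hence form a transversal
  let ρ : F × F → F × F := fun z => (-z.2, -z.1 - z.2)
  have hρ : ∀ z, linearMate 1 (ρ z) z = 0 := fun z => by
    refine Prod.ext ?_ ?_ <;> simp only [linearMate, ρ, Prod.fst_zero, Prod.snd_zero] <;> ring
  have hρi : Function.Injective ρ := by
    rintro ⟨a, b⟩ ⟨c, d⟩ h
    simp only [ρ, Prod.mk.injEq] at h
    exact Prod.ext (by linear_combination h.1 - h.2) (by linear_combination -h.1)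
  have hτi : Function.Injective fun z => prodAddSquare A (ρ z) z := fun z z' h =>
    (prodAddSquare_linearMate_orthogonal hA2 one_ne_zero _ _ _ _ h ((hρ z).trans (hρ z').symm)).2
  let eρ := Equiv.ofBijective ρ (Finite.injective_iff_bijective.1 hρi)
  let eτ := Equiv.ofBijective _ (Finite.injective_iff_bijective.1 hτi)
  have ε : Fin (p ^ 2) ≃ F × F := Fintype.equivOfCardEq (by simp [F, ZMod.card, sq])
  have : Nonempty (Fin (p ^ 2)) := ⟨ε.symm 0⟩
  -- Permuting rows by `ρ` puts the transversal on the diagonal; renaming symbols by `eτ.symm` makes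
  -- its entries the indices. The mates need only the same row permutation, since renaming symbols
  -- preserves orthogonality.
  let L : Fin (p ^ 2) → Fin (p ^ 2) → Fin (p ^ 2) := fun u v =>
    ε.symm (eτ.symm (prodAddSquare A (eρ (ε u)) (ε v)))
  let K : F → Fin (p ^ 2) → Fin (p ^ 2) → Fin (p ^ 2) := fun b u v =>
    ε.symm (linearMate b (eρ (ε u)) (ε v))
  have hLeq : ∀ {u v u' v'}, L u v = L u' v' →
      prodAddSquare A (eρ (ε u)) (ε v) = prodAddSquare A (eρ (ε u')) (ε v') :=
    fun h => eτ.symm.injective (ε.symm.injective h)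
  have hKeq : ∀ {b u v u' v'}, K b u v = K b u' v' →
      linearMate b (eρ (ε u)) (ε v) = linearMate b (eρ (ε u')) (ε v') :=
    fun h => ε.symm.injective h
  have hcell : ∀ {u v u' v' : Fin (p ^ 2)}, eρ (ε u) = eρ (ε u') ∧ ε v = ε v' → u = u' ∧ v = v' :=
    fun h => ⟨ε.injective (eρ.injective h.1), ε.injective h.2⟩
  have hKinj : Function.Injective fun b => tripleSet (K b) := by
    refine tripleSet_injective.comp fun b b' h => linearMate_injective ?_
    funext x y
    have := congrFun (congrFun h (ε.symm (eρ.symm x))) (ε.symm y)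
    simpa [K] using this
  refine ⟨p ^ 2, tripleSet L, ?_, ?_, ?_, ?_, ?_⟩
  · calc p ^ 2 ≤ (2 * (2 * n)) ^ 2 := Nat.pow_le_pow_left hle 2
      _ = 16 * n ^ 2 := by ring
  · exact isLatinSquare_tripleSet
      (fun u v v' h => ε.injective (prodAddSquare_injective_right hA1 _ (hLeq h)))
      (fun v u u' h => ε.injective (eρ.injective (prodAddSquare_injective_left hA2 _ (hLeq h))))
  -- The layer with second coordinate `0` is a copy of `A`, because `0 + 0 = 0`.
  · refine ⟨fun r => ε.symm (eρ.symm (f₁ r, 0)), fun c => ε.symm (f₂ c, 0),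
      fun e => ε.symm (eτ.symm (f₃ e, 0)), ?_, ?_, ?_, ?_⟩
    · intro r r' h
      exact h₁ (by simpa using h)
    · intro c c' h
      exact h₂ (by simpa using h)
    · intro e e' h
      exact h₃ (by simpa using h)
    · intro r c e he
      simp [mem_tripleSet, L, prodAddSquare, hA r c e he]
  · refine ⟨(Finset.univ.erase (0 : F)).map ⟨_, hKinj⟩, ?_, ?_, ?_⟩
    · rw [Finset.card_map, Finset.card_erase_of_mem (Finset.mem_univ _), Finset.card_univ,
        ZMod.card]
      omega
    · intro X hX
      simp only [Finset.mem_map, Finset.mem_erase, Finset.mem_univ, and_true,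
        Function.Embedding.coeFn_mk] at hX
      obtain ⟨b, hb, rfl⟩ := hX
      exact ⟨isLatinSquare_tripleSet
        (fun u v v' h => ε.injective (linearMate_injective_right hb _ (hKeq h)))
        (fun v u u' h => ε.injective (eρ.injective (linearMate_injective_left b _ (hKeq h)))),
        orthogonalSquares_tripleSet fun u v u' v' h h' =>
          hcell (prodAddSquare_linearMate_orthogonal hA2 hb _ _ _ _ (hLeq h) (hKeq h'))⟩
    · intro X hX Y hY hXY
      simp only [Finset.mem_map, Function.Embedding.coeFn_mk] at hX hY
      obtain ⟨b, -, rfl⟩ := hX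
      obtain ⟨b', -, rfl⟩ := hY
      have hbb : b ≠ b' := fun h => hXY (h ▸ rfl)
      exact orthogonalSquares_tripleSet fun u v u' v' h h' =>
        hcell (linearMate_orthogonal hbb _ _ _ _ (hKeq h) (hKeq h'))
  · intro _ a
    rw [mem_tripleSet]
    change ε.symm (eτ.symm (eτ (ε a))) = a
    simp
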